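/- Let $k$ be a commutative ring and let $V$ be the category of $k$-modules; all categories and functors below are $k$-linear. For a small $k$-linear category $C$, let $[C^{op},V]$ be the category of $k$-linear functors $C^{op}\to V$ and natural transformations, and let $\mathrm{Lex}[C^{op},V]$ be its full subcategory of left exact functors, i.e. those preserving finite limits. For small $k$-linear categories $A,B$, let $A\otimes B$ be the $k$-linear category whose objects are the pairs $(a,b)$ with $a\in A$, $b\in B$ and whose hom-modules are $(A\otimes B)((a,b),(a',b'))=A(a,a')\otimes_k B(b,b')$, and let $\mathrm{Lex}[A^{op},B^{op};V]$ be the full subcategory of $[(A\otimes B)^{op},V]$ on the functors $F$ that are left exact in each variable, i.e. such that $F(-,b):A^{op}\to V$ and $F(a,-):B^{op}\to V$ are left exact for all $a\in A$ and $b\in B$. Suppose that $A$ and $B$ are small $k$-linear categories with finite colimits and that $\mathrm{Lex}[A^{op},V]$ and $\mathrm{Lex}[B^{op},V]$ are abelian. Then the inclusion $$\mathrm{Lex}[A^{op},B^{op};V]\subseteq[(A\otimes B)^{op},V]$$ has a left adjoint, this left adjoint is left exact (it preserves finite limits), and the category $\mathrm{Lex}[A^{op},B^{op};V]$ is abelian.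 In particular, if $A$ and $B$ are small abelian $k$-linear categories, then $\mathrm{Lex}[A^{op},V]$ and $\mathrm{Lex}[B^{op},V]$ are abelian, and hence the same conclusions hold. -/

import Mathlib

open CategoryTheory CategoryTheory.Limits
open scoped TensorProduct

universe w v u v₁ v₂ u₁ u₂

namespace LinCat

/-- The opposite of a `k`-linear category is `k`-linear, with `r • f.op = (r • f).op`. -/
instance oppositeLinear {k : Type w} [Semiring k] {C : Type u} [Category.{v} C] [Preadditive C]
    [Linear k C] : Linear k Cᵒᵖ where
  homModule X Y :=
    { smul := fun r f => (r • f.unop).op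
      one_smul := fun f => Quiver.Hom.unop_inj (one_smul k f.unop)
      mul_smul := fun r s f => Quiver.Hom.unop_inj (mul_smul r s f.unop)
      smul_zero := fun r => Quiver.Hom.unop_inj (smul_zero (A := Y.unop ⟶ X.unop) r)
      smul_add := fun r f g => Quiver.Hom.unop_inj (smul_add r f.unop g.unop)
      add_smul := fun r s f => Quiver.Hom.unop_inj (add_smul r s f.unop)
      zero_smul := fun f => Quiver.Hom.unop_inj (zero_smul k f.unop) }
  smul_comp _ _ _ r f g := Quiver.Hom.unop_inj (Linear.comp_smul _ _ _ g.unop r f.unop)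
  comp_smul _ _ _ f r g := Quiver.Hom.unop_inj (Linear.smul_comp _ _ _ r g.unop f.unop)

@[simp]
theorem unop_smul {k : Type w} [Semiring k] {C : Type u} [Category.{v} C] [Preadditive C]
    [Linear k C] {X Y : Cᵒᵖ} (r : k) (f : X ⟶ Y) : (r • f).unop = r • f.unop := rfl

/-- The category `C`, with its given preadditive structure, is abelian. -/
def IsAbelian (C : Type u) [Category.{v} C] [p : Preadditive C] : Prop :=
  ∃ h : Abelian C, h.toPreadditive = p

/-- The tensor product `A ⊗ B` of two `k`-linear categories: its objects are pairs `(a, b)`. -/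
structure Tensor (k : Type w) (A : Type u₁) (B : Type u₂) where
  fst : A
  snd : B

namespace Tensor

variable (k : Type w) [CommRing k]
  (A : Type u₁) [Category.{v₁} A] [Preadditive A] [Linear k A]
  (B : Type u₂) [Category.{v₂} B] [Preadditive B] [Linear k B]

/-- Composition of `A ⊗ B`, as a bilinear map. -/
def compMap (X Y Z : Tensor k A B) :
    ((X.fst ⟶ Y.fst) ⊗[k] (X.snd ⟶ Y.snd)) →ₗ[k] ((Y.fst ⟶ Z.fst) ⊗[k] (Y.snd ⟶ Z.snd)) →ₗ[k]
      ((X.fst ⟶ Z.fst) ⊗[k] (X.snd ⟶ Z.snd)) :=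
  TensorProduct.map₂ (Linear.comp (S := k) X.fst Y.fst Z.fst)
    (Linear.comp (S := k) X.snd Y.snd Z.snd)

@[simp]
theorem compMap_tmul (X Y Z : Tensor k A B) (f : X.fst ⟶ Y.fst) (g : X.snd ⟶ Y.snd)
    (f' : Y.fst ⟶ Z.fst) (g' : Y.snd ⟶ Z.snd) :
    compMap k A B X Y Z (f ⊗ₜ g) (f' ⊗ₜ g') = (f ≫ f') ⊗ₜ (g ≫ g') := rfl

/-- `(A ⊗ B)((a, b), (a', b')) = A(a, a') ⊗[k] B(b, b')`, with composition determined by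
`(f ⊗ₜ g) ≫ (f' ⊗ₜ g') = (f ≫ f') ⊗ₜ (g ≫ g')`. -/
instance category : Category.{max v₁ v₂} (Tensor k A B) where
  Hom X Y := (X.fst ⟶ Y.fst) ⊗[k] (X.snd ⟶ Y.snd)
  id X := 𝟙 X.fst ⊗ₜ[k] 𝟙 X.snd
  comp {X Y Z} f g := compMap k A B X Y Z f g
  id_comp f := by
    induction f using TensorProduct.induction_on with
    | zero => simp
    | tmul a b => simp
    | add a b ha hb => rw [map_add, ha, hb]
  comp_id f := by
    induction f using TensorProduct.induction_on with
    | zero => simp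
    | tmul a b => simp
    | add a b ha hb => rw [map_add, LinearMap.add_apply, ha, hb]
  assoc f g h := by
    induction f using TensorProduct.induction_on with
    | zero => simp
    | add a b ha hb => simp only [map_add, LinearMap.add_apply, ha, hb]
    | tmul a b =>
      induction g using TensorProduct.induction_on with
      | zero => simp
      | add a b ha hb => simp only [map_add, LinearMap.add_apply, ha, hb]
      | tmul c d =>
        induction h using TensorProduct.induction_on with
        | zero => simp
        | add a b ha hb => simp only [map_add, ha, hb]
        | tmul e f => simp

variable {k A B}

/-- The morphism `f ⊗ g` of `A ⊗ B`. -/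
def tmul {X Y : Tensor k A B} (f : X.fst ⟶ Y.fst) (g : X.snd ⟶ Y.snd) : X ⟶ Y :=
  (f ⊗ₜ[k] g : (X.fst ⟶ Y.fst) ⊗[k] (X.snd ⟶ Y.snd))

theorem tmul_id (X : Tensor k A B) : tmul (𝟙 X.fst) (𝟙 X.snd) = 𝟙 X := rfl

theorem tmul_comp_tmul {X Y Z : Tensor k A B} (f : X.fst ⟶ Y.fst) (g : X.snd ⟶ Y.snd)
    (f' : Y.fst ⟶ Z.fst) (g' : Y.snd ⟶ Z.snd) :
    tmul f g ≫ tmul f' g' = tmul (f ≫ f') (g ≫ g') :=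
  compMap_tmul k A B X Y Z f g f' g'

instance preadditive : Preadditive (Tensor k A B) where
  homGroup X Y := inferInstanceAs (AddCommGroup ((X.fst ⟶ Y.fst) ⊗[k] (X.snd ⟶ Y.snd)))
  add_comp X Y Z f f' g := LinearMap.map_add₂ (compMap k A B X Y Z) f f' g
  comp_add X Y Z f g g' := (compMap k A B X Y Z f).map_add g g'

instance linear : Linear k (Tensor k A B) where
  homModule X Y := inferInstanceAs (Module k ((X.fst ⟶ Y.fst) ⊗[k] (X.snd ⟶ Y.snd)))
  smul_comp X Y Z r f g := LinearMap.map_smul₂ (compMap k A B X Y Z) r f g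
  comp_smul X Y Z f r g := (compMap k A B X Y Z f).map_smul r g

variable (k A B)

/-- The functor `A ⥤ A ⊗ B`, `x ↦ (x, b)`, for a fixed object `b`. -/
def inFst (b : B) : A ⥤ Tensor k A B where
  obj x := ⟨x, b⟩
  map f := tmul (X := ⟨_, b⟩) (Y := ⟨_, b⟩) f (𝟙 b)
  map_id _ := rfl
  map_comp f g := by rw [tmul_comp_tmul, Category.comp_id]

/-- The functor `B ⥤ A ⊗ B`, `y ↦ (a, y)`, for a fixed object `a`. -/
def inSnd (a : A) : B ⥤ Tensor k A B where
  obj y := ⟨a, y⟩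
  map g := tmul (X := ⟨a, _⟩) (Y := ⟨a, _⟩) (𝟙 a) g
  map_id _ := rfl
  map_comp f g := by rw [tmul_comp_tmul, Category.comp_id]

end Tensor

section Presheaves

variable (k : Type u) [CommRing k]

/-- The category `[Cᵒᵖ, V]` of `k`-linear functors `Cᵒᵖ ⥤ V` and all natural transformations
between them, for a `k`-linear category `C` and `V` the category of `k`-modules. -/
abbrev Presheaf (C : Type u) [Category.{u} C] [Preadditive C] [Linear k C] :=
  ObjectProperty.FullSubcategory
    (fun F : Cᵒᵖ ⥤ ModuleCat.{u} k => F.Additive ∧ F.Linear k)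

/-- A `k`-linear functor `Cᵒᵖ ⥤ V` is left exact if it preserves finite limits. -/
def isLex (C : Type u) [Category.{u} C] [Preadditive C] [Linear k C] :
    ObjectProperty (Presheaf k C) :=
  fun F => PreservesFiniteLimits F.obj

/-- `Lex[Cᵒᵖ, V]`, as a full subcategory of `[Cᵒᵖ, V]`. -/
abbrev Lex (C : Type u) [Category.{u} C] [Preadditive C] [Linear k C] :=
  (isLex k C).FullSubcategory

variable (A : Type u) [Category.{u} A] [Preadditive A] [Linear k A]
  (B : Type u) [Category.{u} B] [Preadditive B] [Linear k B]

/-- A `k`-linear functor `F : (A ⊗ B)ᵒᵖ ⥤ V` is left exact in each variable if all the functors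
`F(-, b) : Aᵒᵖ ⥤ V` and `F(a, -) : Bᵒᵖ ⥤ V` preserve finite limits. -/
def isBiLex : ObjectProperty (Presheaf k (Tensor k A B)) :=
  fun F => (∀ b : B, PreservesFiniteLimits ((Tensor.inFst k A B b).op ⋙ F.obj)) ∧
    (∀ a : A, PreservesFiniteLimits ((Tensor.inSnd k A B a).op ⋙ F.obj))

/-- `Lex[Aᵒᵖ, Bᵒᵖ; V]`, as a full subcategory of `[(A ⊗ B)ᵒᵖ, V]`. -/
abbrev BiLex := (isBiLex k A B).FullSubcategory

/-- The inclusion `Lex[Aᵒᵖ, Bᵒᵖ; V] ⥤ [(A ⊗ B)ᵒᵖ, V]`. -/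
abbrev biLexInclusion : BiLex k A B ⥤ Presheaf k (Tensor k A B) := (isBiLex k A B).ι

end Presheaves

end LinCat

/-! Left exactness is recognised as a sheaf condition. A class `W` of morphisms that contains
identities, is closed under composition and satisfies the right Ore condition defines a topology
whose covering sieves are those containing a member of `W`. An additive presheaf is a sheaf iff it
has descent along every member of `W` (`isSheaf_topology_iff`), and sheafification preserves
linearity. So the linear sheaves are a left exact reflective subcategory of the abelian category of
linear presheaves, hence abelian (`IsCovering.localization`).

If `Lex k A` is abelian, the epimorphisms of `A` form such a class and its linear sheaves are the
left exact functors (`IsEpiDescent.of_isAbelian_lex`). Refinements along epimorphisms exist in `Lex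
k A`; they come down to `A` because an epimorphism onto a representable takes an epimorphism of `A`
as a value (`exists_epi_of_epi_yonedaLex`, by a reduced product of representables). For abelian `A`
the same axioms hold directly.

On `A ⊗ B` the class consists of the `p ⊗ q` with `p`, `q` epimorphisms. Descent in each variable
gives descent along `p ⊗ q`. Conversely, a morphism killed by `p ⊗ 1` becomes, after refinement, a
sum of tensors whose first factors are killed by `p`; this rests on the finiteness statement
`exists_fg_of_rTensor_eq_zero`. Hence `isBiLex_iff_isSheaf`, and the localization result applies. -/

namespace LinCat

open Opposite

/-! ### Linear presheaves form an abelian category. -/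

section LinearFunctors

variable (k : Type u) [CommRing k] (C : Type u) [Category.{u} C] [Preadditive C] [Linear k C]

/-- The property of being a `k`-linear functor `Cᵒᵖ ⥤ V`. -/
abbrev isLinear : ObjectProperty (Cᵒᵖ ⥤ ModuleCat.{u} k) :=
  fun F => F.Additive ∧ F.Linear k

variable {k C}

instance (F : Presheaf k C) : F.obj.Additive := F.property.1

instance (F : Presheaf k C) : F.obj.Linear k := F.property.2

/-- Limits of presheaves are pointwise, so the equations expressing linearity can be tested after
the projections. -/
instance isLinear_isClosedUnderLimitsOfShape (J : Type v) [Category.{w} J]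
    [HasLimitsOfShape J (ModuleCat.{u} k)] : (isLinear k C).IsClosedUnderLimitsOfShape J where
  limitsOfShape_le X := by
    rintro ⟨h⟩
    have hl (c : Cᵒᵖ) := isLimitOfPreserves ((evaluation _ _).obj c) h.isLimit
    have hA (j : J) : (h.diag.obj j).Additive := (h.prop_diag_obj j).1
    have hL (j : J) : (h.diag.obj j).Linear k := (h.prop_diag_obj j).2
    have hn (j : J) {a b : Cᵒᵖ} (f : a ⟶ b) :
        X.map f ≫ (h.π.app j).app b = (h.π.app j).app a ≫ (h.diag.obj j).map f :=
      (h.π.app j).naturality f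
    refine ⟨⟨fun {a b f g} => (hl b).hom_ext fun j => ?_⟩,
      ⟨fun {a b} f r => (hl b).hom_ext fun j => ?_⟩⟩
    · change X.map (f + g) ≫ (h.π.app j).app b = (X.map f + X.map g) ≫ (h.π.app j).app b
      rw [Preadditive.add_comp, hn, hn, hn, ← Preadditive.comp_add]
      exact congrArg _ (h.diag.obj j).map_add
    · change X.map (r • f) ≫ (h.π.app j).app b = (r • X.map f) ≫ (h.π.app j).app b
      rw [Linear.smul_comp, hn, hn, ← Linear.comp_smul]
      exact congrArg _ ((h.diag.obj j).map_smul r f)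

instance isLinear_isClosedUnderColimitsOfShape (J : Type v) [Category.{w} J]
    [HasColimitsOfShape J (ModuleCat.{u} k)] :
    (isLinear k C).IsClosedUnderColimitsOfShape J where
  colimitsOfShape_le X := by
    rintro ⟨h⟩
    have hl (c : Cᵒᵖ) := isColimitOfPreserves ((evaluation _ _).obj c) h.isColimit
    have hA (j : J) : (h.diag.obj j).Additive := (h.prop_diag_obj j).1
    have hL (j : J) : (h.diag.obj j).Linear k := (h.prop_diag_obj j).2
    have hn (j : J) {a b : Cᵒᵖ} (f : a ⟶ b) :
        (h.ι.app j).app a ≫ X.map f = (h.diag.obj j).map f ≫ (h.ι.app j).app b :=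
      ((h.ι.app j).naturality f).symm
    refine ⟨⟨fun {a b f g} => (hl a).hom_ext fun j => ?_⟩,
      ⟨fun {a b} f r => (hl a).hom_ext fun j => ?_⟩⟩
    · change (h.ι.app j).app a ≫ X.map (f + g) = (h.ι.app j).app a ≫ (X.map f + X.map g)
      rw [Preadditive.comp_add, hn, hn, hn, ← Preadditive.add_comp]
      exact congrArg (· ≫ _) (h.diag.obj j).map_add
    · change (h.ι.app j).app a ≫ X.map (r • f) = (h.ι.app j).app a ≫ (r • X.map f)
      rw [Linear.comp_smul, hn, hn, ← Linear.smul_comp]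
      exact congrArg (· ≫ _) ((h.diag.obj j).map_smul r f)

instance isLinear_isClosedUnderKernels : (isLinear k C).IsClosedUnderKernels where
  kernels_le := by
    rintro _ ⟨f, c, hc, hf⟩
    exact ObjectProperty.prop_of_isLimit _ hc (by rintro (_ | _); exacts [hf.1, hf.2])

instance isLinear_isClosedUnderCokernels : (isLinear k C).IsClosedUnderCokernels where
  cokernels_le := by
    rintro _ ⟨f, c, hc, hf⟩
    exact ObjectProperty.prop_of_isColimit _ hc (by rintro (_ | _); exacts [hf.1, hf.2])

instance isLinear_isClosedUnderFiniteProducts : (isLinear k C).IsClosedUnderFiniteProducts where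

instance isLinear_containsZero : (isLinear k C).ContainsZero where
  exists_zero := ⟨⊤_ (Cᵒᵖ ⥤ ModuleCat.{u} k), (isZero_zero (Cᵒᵖ ⥤ ModuleCat.{u} k)).of_iso
    (terminalIsTerminal.uniqueUpToIso (isZero_zero (Cᵒᵖ ⥤ ModuleCat.{u} k)).isTerminal),
    (isLinear k C).prop_terminal⟩

noncomputable instance presheafAbelian : Abelian (Presheaf k C) :=
  inferInstanceAs (Abelian (isLinear k C).FullSubcategory)

end LinearFunctors

end LinCat

/-! ### Topologies from Ore classes, and descent. -/

namespace LinCat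

open Opposite

/-- A class of morphisms which contains the identities, is stable under composition and satisfies
the right Ore condition. -/
structure IsCovering {C : Type u} [Category.{v} C] (W : MorphismProperty C) : Prop where
  id_mem : ∀ X : C, W (𝟙 X)
  comp_mem : ∀ {X Y Z : C} (f : X ⟶ Y) (g : Y ⟶ Z), W f → W g → W (f ≫ g)
  ore : ∀ {X Y Z : C} (p : X ⟶ Y) (g : Z ⟶ Y), W p →
    ∃ (T : C) (t : T ⟶ Z) (g' : T ⟶ X), W t ∧ t ≫ g = g' ≫ p

namespace IsCovering

variable {C : Type u} [Category.{v} C] {W : MorphismProperty C} (hW : IsCovering W)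

-- The Ore condition controls one leg of the square only, so what lies in `W` is the common
-- composite.
include hW in
theorem exists_common {X Y Z : C} {p : X ⟶ Y} {q : Z ⟶ Y} (hp : W p) (hq : W q) :
    ∃ (T : C) (t : T ⟶ X) (s : T ⟶ Z), W (s ≫ q) ∧ t ≫ p = s ≫ q := by
  obtain ⟨T, t, g', ht, h⟩ := hW.ore p q hp
  exact ⟨T, g', t, hW.comp_mem _ _ ht hq, h.symm⟩

/-- The topology for which a sieve is covering if it contains a morphism in `W`. -/
def topology : GrothendieckTopology C where
  sieves X := {S | ∃ (Z : C) (p : Z ⟶ X), W p ∧ S p}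
  top_mem' X := ⟨X, 𝟙 X, hW.id_mem X, trivial⟩
  pullback_stable' X Y S f := by
    rintro ⟨Z, p, hp, hS⟩
    obtain ⟨T, t, g', ht, h⟩ := hW.ore p f hp
    exact ⟨T, t, ht, by simpa [h] using S.downward_closed hS g'⟩
  transitive' X S := by
    rintro ⟨Z, p, hp, hS⟩ R hR
    obtain ⟨T, t, ht, h⟩ := hR hS
    exact ⟨T, t ≫ p, hW.comp_mem _ _ ht hp, h⟩

end IsCovering

section Descent

variable {k : Type u} [CommRing k]

/-- The sequence `0 ⟶ F Y ⟶ F X ⟶ ∏ F Z` is exact, where the product runs over all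
`w : Z ⟶ X` with `w ≫ p = 0`. -/
structure IsDescent {C : Type u₁} [Category.{v₁} C] [Preadditive C] (F : Cᵒᵖ ⥤ ModuleCat.{v} k)
    {X Y : C} (p : X ⟶ Y) : Prop where
  injective : Function.Injective (F.map p.op)
  exists_map_eq : ∀ x : F.obj (op X), (∀ ⦃Z : C⦄ (w : Z ⟶ X), w ≫ p = 0 → F.map w.op x = 0) →
    ∃ y, F.map p.op y = x

variable {C : Type u} [Category.{u} C] [Preadditive C]

theorem map_comp_op_apply {C : Type u₁} [Category.{v₁} C] (F : Cᵒᵖ ⥤ ModuleCat.{v} k) {X Y Z : C}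
    (f : X ⟶ Y) (g : Y ⟶ Z) (x : F.obj (op Z)) :
    F.map (f ≫ g).op x = F.map f.op (F.map g.op x) := by
  simp

theorem map_sub_op_apply {C : Type u₁} [Category.{v₁} C] [Preadditive C]
    (F : Cᵒᵖ ⥤ ModuleCat.{v} k) [F.Additive] {X Y : C}
    (f g : X ⟶ Y) (x : F.obj (op Y)) :
    F.map (f - g).op x = F.map f.op x - F.map g.op x := by
  rw [op_sub, F.map_sub]; rfl

theorem map_add_op_apply {C : Type u₁} [Category.{v₁} C] [Preadditive C]
    (F : Cᵒᵖ ⥤ ModuleCat.{v} k) [F.Additive] {X Y : C}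
    (f g : X ⟶ Y) (x : F.obj (op Y)) :
    F.map (f + g).op x = F.map f.op x + F.map g.op x := by
  rw [op_add, F.map_add]; rfl

theorem map_zero_op_apply {C : Type u₁} [Category.{v₁} C] [Preadditive C]
    (F : Cᵒᵖ ⥤ ModuleCat.{v} k) [F.Additive] {X Y : C} (x : F.obj (op Y)) :
    F.map (0 : X ⟶ Y).op x = 0 := by
  rw [op_zero, F.map_zero]; rfl

theorem map_smul_op_apply {C : Type u₁} [Category.{v₁} C] [Preadditive C] [Linear k C]
    (F : Cᵒᵖ ⥤ ModuleCat.{v} k) [F.Additive] [F.Linear k] {X Y : C}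
    (r : k) (f : X ⟶ Y) (x : F.obj (op Y)) :
    F.map (r • f).op x = r • F.map f.op x := by
  have : (r • f).op = r • f.op := rfl
  rw [this, F.map_smul]; rfl

/-- Compatibility compares `u` and `v` with `u ≫ p = v ≫ p`; by additivity only the difference `u -
v`, which `p` kills, matters. -/
theorem isSheafFor_singleton_iff_isDescent (F : Cᵒᵖ ⥤ ModuleCat.{u} k) [F.Additive] {X Y : C}
    (p : X ⟶ Y) :
    Presieve.IsSheafFor (F ⋙ forget _) (Presieve.singleton p) ↔ IsDescent F p := by
  rw [Presieve.isSheafFor_singleton]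
  constructor
  · intro h
    refine ⟨fun y y' hy => ?_, fun x hx => ?_⟩
    · obtain ⟨z, -, hz⟩ := h (F.map p.op y) fun u v huv => by
        change F.map u.op (F.map p.op y) = F.map v.op (F.map p.op y)
        rw [← map_comp_op_apply, ← map_comp_op_apply, huv]
      exact (hz y rfl).trans (hz y' hy.symm).symm
    · obtain ⟨z, hz, -⟩ := h x fun u v huv => by
        change F.map u.op x = F.map v.op x
        rw [← sub_eq_zero, ← map_sub_op_apply]
        exact hx _ (by rw [Preadditive.sub_comp, huv, sub_self])
      exact ⟨z, hz⟩
  · intro h x hx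
    obtain ⟨y, hy⟩ := h.exists_map_eq x fun Z w hw => by
      have := hx w 0 (by simpa using hw)
      exact this.trans (map_zero_op_apply F x)
    exact ⟨y, hy, fun y' hy' => h.injective (hy'.trans hy.symm)⟩

/-- A covering sieve contains some `p` in `W`, and descent along `p` produces the only possible
amalgamation. Its restriction along another `s` of the sieve is checked after an Ore refinement `t`,
where restriction is injective. -/
theorem isSheaf_topology_iff {W : MorphismProperty C} (hW : IsCovering W)
    (F : Cᵒᵖ ⥤ ModuleCat.{u} k) [F.Additive] :
    Presheaf.IsSheaf hW.topology F ↔ ∀ ⦃X Y : C⦄ (p : X ⟶ Y), W p → IsDescent F p := by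
  rw [Presheaf.isSheaf_iff_isSheaf_forget hW.topology F (forget (ModuleCat.{u} k)),
    isSheaf_iff_isSheaf_of_type]
  constructor
  · intro h X Y p hp
    rw [← isSheafFor_singleton_iff_isDescent, Presieve.isSheafFor_iff_generate]
    exact h _ ⟨X, p, hp, ⟨X, 𝟙 X, p, Presieve.singleton.mk, by simp⟩⟩
  · rintro h Y S ⟨X, p, hp, hS⟩
    rw [← Presieve.isSeparatedFor_and_exists_isAmalgamation_iff_isSheafFor]
    constructor
    · intro x y y' hy hy'
      exact (h p hp).injective ((hy p hS).trans (hy' p hS).symm)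
    · intro x hx
      obtain ⟨y, hy⟩ := (h p hp).exists_map_eq (x p hS) fun Z w hw => by
        have := hx w (0 : Z ⟶ X) hS hS (by simpa using hw)
        exact this.trans (map_zero_op_apply F _)
      refine ⟨y, fun Z s hs => ?_⟩
      obtain ⟨T, t, s', ht, e⟩ := hW.ore p s hp
      apply (h t ht).injective
      change F.map t.op (F.map s.op y) = F.map t.op (x s hs)
      have h1 : F.map t.op (x s hs) = F.map s'.op (x p hS) := hx t s' hs hS e
      rw [h1, ← map_comp_op_apply, e, map_comp_op_apply, hy]

variable [Linear k C]

/-- Locally every section of `G` comes from the linear presheaf `F`, and the Ore condition moves the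
morphisms to such a local lift. Since restriction along `W` is injective on `G`, the identities
proved there hold globally. -/
theorem isLinear_of_isLocallySurjective {W : MorphismProperty C} (hW : IsCovering W)
    {F G : Cᵒᵖ ⥤ ModuleCat.{u} k} (hF : isLinear k C F) (hG : Presheaf.IsSheaf hW.topology G)
    (φ : F ⟶ G) [Presheaf.IsLocallySurjective hW.topology φ] : isLinear k C G := by
  have hinj {X Y : C} (p : X ⟶ Y) (hp : W p) : Function.Injective (G.map p.op) := by
    rw [Presheaf.isSheaf_iff_isSheaf_forget hW.topology G (forget (ModuleCat.{u} k)),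
      isSheaf_iff_isSheaf_of_type] at hG
    intro y y' h
    refine ((Presieve.isSheafFor_iff_generate _).2
      (hG (Sieve.generate (Presieve.singleton p))
        ⟨X, p, hp, ⟨X, 𝟙 X, p, Presieve.singleton.mk, by simp⟩⟩)).isSeparatedFor.ext ?_
    rintro _ _ ⟨⟩
    exact h
  have hφ {X Y : C} (f : X ⟶ Y) (x : F.obj (op Y)) :
      G.map f.op (φ.app _ x) = φ.app _ (F.map f.op x) :=
    (NatTrans.naturality_apply φ f.op x).symm
  have hA := hF.1
  have hL := hF.2
  have key {X Y : C} (f : X ⟶ Y) (x : G.obj (op Y)) : ∃ (Z : C) (p : Z ⟶ Y) (y : F.obj (op Z)),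
      W p ∧ φ.app _ y = G.map p.op x := by
    obtain ⟨Z, p, hp, y, hy⟩ := Presheaf.imageSieve_mem hW.topology φ x
    exact ⟨Z, p, y, hp, hy⟩
  refine ⟨⟨fun {Y X f g} => ?_⟩, ⟨fun {Y X} f r => ?_⟩⟩
  · induction Y using Opposite.rec with | _ Y
    induction X using Opposite.rec with | _ X
    ext x
    change G.map (f.unop + g.unop).op x = G.map f.unop.op x + G.map g.unop.op x
    generalize f.unop = f
    generalize g.unop = g
    obtain ⟨Z, p, y, hp, hy⟩ := key f x
    obtain ⟨T, t, f', ht, hf⟩ := hW.ore p f hp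
    obtain ⟨S, s, g', hs, hg⟩ := hW.ore p (t ≫ g) hp
    apply hinj _ (hW.comp_mem _ _ hs ht)
    have e1 : (s ≫ t) ≫ f = (s ≫ f') ≫ p := by simp [hf]
    have e2 : (s ≫ t) ≫ g = g' ≫ p := by simpa using hg
    have e3 : (s ≫ t) ≫ (f + g) = (s ≫ f' + g') ≫ p := by
      rw [Preadditive.comp_add, e1, e2, Preadditive.add_comp]
    rw [map_add, ← map_comp_op_apply, ← map_comp_op_apply, ← map_comp_op_apply, e1, e2, e3,
      map_comp_op_apply, map_comp_op_apply _ _ p, map_comp_op_apply _ g' p, ← hy, hφ, hφ, hφ,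
      map_add_op_apply, map_add]
  · induction Y using Opposite.rec with | _ Y
    induction X using Opposite.rec with | _ X
    ext x
    change G.map (r • f.unop).op x = r • G.map f.unop.op x
    generalize f.unop = f
    obtain ⟨Z, p, y, hp, hy⟩ := key f x
    obtain ⟨T, t, f', ht, hf⟩ := hW.ore p f hp
    apply hinj _ ht
    have e3 : t ≫ (r • f) = (r • f') ≫ p := by
      rw [Linear.comp_smul, hf, Linear.smul_comp]
    rw [map_smul, ← map_comp_op_apply, ← map_comp_op_apply, e3, hf,
      map_comp_op_apply, map_comp_op_apply, ← hy, hφ, hφ, map_smul_op_apply, map_smul]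

end Descent

end LinCat

/-! ### Linear sheaves as a left exact localization. -/

namespace LinCat

open Opposite

variable {k : Type u} [CommRing k] {C : Type u} [Category.{u} C] [Preadditive C] [Linear k C]

namespace IsCovering

variable {W : MorphismProperty C} (hW : IsCovering W) (P : ObjectProperty (Presheaf k C))
  (hP : ∀ F, P F ↔ Presheaf.IsSheaf hW.topology F.obj)

/-- The sheaf underlying a linear presheaf satisfying `P`. -/
def toSheaf : P.FullSubcategory ⥤ Sheaf hW.topology (ModuleCat.{u} k) :=
  ObjectProperty.lift _ (P.ι ⋙ (isLinear k C).ι) fun F => (hP _).1 F.property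

/-- The functor `toSheaf` is fully faithful. -/
def fullyFaithfulToSheaf : (hW.toSheaf P hP).FullyFaithful where
  preimage f := P.homMk ((isLinear k C).homMk f.hom)

theorem isLinear_sheafify (F : Presheaf k C) :
    isLinear k C (sheafify hW.topology F.obj) :=
  isLinear_of_isLocallySurjective hW F.property ((presheafToSheaf hW.topology _).obj F.obj).property
    (toSheafify hW.topology F.obj)

/-- Sheafification of linear presheaves. -/
noncomputable def reflector : Presheaf k C ⥤ P.FullSubcategory :=
  P.lift ((isLinear k C).lift ((isLinear k C).ι ⋙ sheafification hW.topology (ModuleCat.{u} k))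
    (hW.isLinear_sheafify)) fun F => (hP _).2 ((presheafToSheaf hW.topology _).obj F.obj).property

/-- Sheafification of linear presheaves is left adjoint to the inclusion. -/
noncomputable def reflectorAdjunction : hW.reflector P hP ⊣ P.ι :=
  (sheafificationAdjunction hW.topology (ModuleCat.{u} k)).restrictFullyFaithful
    (isLinear k C).fullyFaithfulι (hW.fullyFaithfulToSheaf P hP) (Iso.refl _) (Iso.refl _)

/-- Followed by the fully faithful `toSheaf`, which reflects limits, the reflector is ordinary
sheafification restricted to linear presheaves. -/
theorem preservesFiniteLimits_reflector : PreservesFiniteLimits (hW.reflector P hP) := by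
  have h1 : PreservesFiniteLimits (isLinear k C).ι := ⟨fun J _ _ => inferInstance⟩
  have h2 : PreservesFiniteLimits (hW.reflector P hP ⋙ hW.toSheaf P hP) :=
    inferInstanceAs (PreservesFiniteLimits ((isLinear k C).ι ⋙
      presheafToSheaf hW.topology (ModuleCat.{u} k)))
  have := (hW.fullyFaithfulToSheaf P hP).full
  have := (hW.fullyFaithfulToSheaf P hP).faithful
  exact preservesFiniteLimits_of_reflects_of_preserves _ (hW.toSheaf P hP)

-- Left adjoints are unique up to isomorphism, so exactness of one reflector gives it for all; a
-- left exact reflective localization of an abelian category is abelian.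
include hP in
theorem localization :
    P.ι.IsRightAdjoint ∧
      (∀ R : Presheaf k C ⥤ P.FullSubcategory, Nonempty (R ⊣ P.ι) → PreservesFiniteLimits R) ∧
      IsAbelian P.FullSubcategory := by
  have hR := hW.preservesFiniteLimits_reflector P hP
  have adj := hW.reflectorAdjunction P hP
  refine ⟨⟨_, ⟨adj⟩⟩, ?_, ?_⟩
  · rintro R ⟨adj'⟩
    exact preservesFiniteLimits_of_natIso (adj.leftAdjointUniq adj')
  · let _ : Reflective P.ι := ⟨_, adj⟩
    have : HasFiniteProducts P.FullSubcategory :=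
      ⟨fun n => hasLimitsOfShape_of_reflective P.ι⟩
    have : (hW.reflector P hP).Additive := adj.left_adjoint_additive
    exact ⟨abelianOfAdjunction P.ι (hW.reflector P hP) (asIso adj.counit) adj, rfl⟩

end IsCovering

end LinCat

/-! ### Left exact functors as sheaves for the epimorphisms. -/

namespace LinCat

open Opposite

variable {k : Type u} [CommRing k]

section Lex

variable {A : Type u} [Category.{u} A]

theorem injective_map_of_epi (F : Aᵒᵖ ⥤ ModuleCat.{u} k) [PreservesFiniteLimits F] {X Y : A}
    (p : X ⟶ Y) [Epi p] : Function.Injective (F.map p.op) :=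
  (ModuleCat.mono_iff_injective _).1 inferInstance

variable [Preadditive A]

theorem exists_map_eq_of_isColimit (F : Aᵒᵖ ⥤ ModuleCat.{u} k) [F.Additive]
    [PreservesFiniteLimits F] {X Y Z : A} {f : X ⟶ Y} {p : Y ⟶ Z} (w : f ≫ p = 0)
    (h : IsColimit (CokernelCofork.ofπ p w)) (x : F.obj (op Y)) (hx : F.map f.op x = 0) :
    ∃ y, F.map p.op y = x := by
  have hl := CokernelCofork.IsColimit.ofπOp p w h
  have hl' := (KernelFork.isLimitMapConeEquiv _ F).1 (isLimitOfPreserves F hl)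
  have w' : F.map p.op ≫ F.map f.op = 0 := by
    rw [← F.map_comp, ← op_comp, w, op_zero, F.map_zero]
  have := ShortComplex.exact_of_f_is_kernel (ShortComplex.mk _ _ w') hl'
  rw [ShortComplex.moduleCat_exact_iff] at this
  exact this x hx

variable [HasFiniteColimits A]

/-- Kernels in `Aᵒᵖ` are cokernels in `A`, and an additive functor that preserves kernels preserves
finite limits. -/
theorem preservesFiniteLimits_of_cokernel (F : Aᵒᵖ ⥤ ModuleCat.{u} k) [F.Additive]
    (h : ∀ ⦃X Y : A⦄ (f : X ⟶ Y), Function.Injective (F.map (cokernel.π f).op) ∧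
      ∀ x, F.map f.op x = 0 → ∃ y, F.map (cokernel.π f).op y = x) :
    PreservesFiniteLimits F := by
  have : HasZeroObject A := hasZeroObject_of_hasInitial_object
  have : HasBinaryBiproducts A := HasBinaryBiproducts.of_hasBinaryCoproducts
  have (X Y : Aᵒᵖ) (g : X ⟶ Y) : PreservesLimit (parallelPair g 0) F := by
    have hl := CokernelCofork.IsColimit.ofπOp (cokernel.π g.unop) (cokernel.condition g.unop)
      (cokernelIsCokernel g.unop)
    refine preservesLimit_of_preserves_limit_cone hl ?_
    refine (KernelFork.isLimitMapConeEquiv _ F).2 ?_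
    have w' : F.map (cokernel.π g.unop).op ≫ F.map g = 0 := by
      rw [← F.map_comp, ← F.map_zero]
      exact congrArg (fun t => F.map t.op) (cokernel.condition g.unop)
    have hm : Mono (F.map (cokernel.π g.unop).op) :=
      (ModuleCat.mono_iff_injective _).2 (h g.unop).1
    have hE : (ShortComplex.mk _ _ w').Exact := by
      rw [ShortComplex.moduleCat_exact_iff]
      exact fun x hx => (h g.unop).2 x hx
    exact hE.fIsKernel
  exact F.preservesFiniteLimits_of_preservesKernels

end Lex

/-- A category for which the left exact functors are the linear sheaves
for the topology generated by the epimorphisms. -/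
structure IsEpiDescent (k : Type u) [CommRing k] (A : Type u) [Category.{u} A] [Preadditive A]
    [Linear k A] [HasFiniteColimits A] : Prop where
  ore : ∀ {X Y Z : A} (p : X ⟶ Y) (g : Z ⟶ Y), Epi p →
    ∃ (T : A) (t : T ⟶ Z) (g' : T ⟶ X), Epi t ∧ t ≫ g = g' ≫ p
  exact : ∀ {X Y Z : A} (f : X ⟶ Y) (g : Z ⟶ Y), g ≫ cokernel.π f = 0 →
    ∃ (T : A) (t : T ⟶ Z) (g' : T ⟶ X), Epi t ∧ t ≫ g = g' ≫ f
  exists_map_eq : ∀ (F : Presheaf k A), isLex k A F → ∀ {X Y : A} (p : X ⟶ Y), Epi p →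
    ∀ x : F.obj.obj (op X), (∀ ⦃Z : A⦄ (w : Z ⟶ X), w ≫ p = 0 → F.obj.map w.op x = 0) →
      ∃ y, F.obj.map p.op y = x

namespace IsEpiDescent

variable {A : Type u} [Category.{u} A] [Preadditive A] [Linear k A] [HasFiniteColimits A]

theorem isCovering (h : IsEpiDescent k A) : IsCovering (MorphismProperty.epimorphisms A) where
  id_mem _ := .infer_property _
  comp_mem f g hf hg := by
    have : Epi f := hf
    have : Epi g := hg
    exact epi_comp f g
  ore p g hp := h.ore p g hp

/-- For the converse, descent is applied to `cokernel.π f`: any `w` that it kills factors through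
`f` after an epimorphism, so an element killed by `f` is killed by `w`. -/
theorem isLex_iff (h : IsEpiDescent k A) (F : Presheaf k A) :
    isLex k A F ↔ ∀ ⦃X Y : A⦄ (p : X ⟶ Y), Epi p → IsDescent F.obj p := by
  constructor
  · intro hF X Y p hp
    have : PreservesFiniteLimits F.obj := hF
    exact ⟨injective_map_of_epi _ p, h.exists_map_eq F hF p hp⟩
  · intro hF
    refine preservesFiniteLimits_of_cokernel _ fun X Y f => ?_
    have hd := hF (cokernel.π f) inferInstance
    refine ⟨hd.injective, fun x hx => hd.exists_map_eq x fun Z w hw => ?_⟩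
    obtain ⟨T, t, g', ht, e⟩ := h.exact f w hw
    apply (hF t ht).injective
    rw [← map_comp_op_apply, e, map_comp_op_apply, hx, map_zero, map_zero]

theorem isAbelian_lex (h : IsEpiDescent k A) : IsAbelian (Lex k A) :=
  (h.isCovering.localization (isLex k A) fun F => by
    rw [h.isLex_iff, isSheaf_topology_iff]).2.2

theorem of_abelian (hA : IsAbelian A) : IsEpiDescent k A := by
  obtain ⟨hA, rfl⟩ := hA
  refine ⟨fun p g hp => ⟨pullback p g, pullback.snd p g, pullback.fst p g, inferInstance,
    pullback.condition.symm⟩, fun {X Y Z} f g hg => ?_, fun F hF X Y p hp x hx => ?_⟩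
  · let S := ShortComplex.mk f (cokernel.π f) (cokernel.condition f)
    have hS : S.Exact := S.exact_of_g_is_cokernel (cokernelIsCokernel f)
    obtain ⟨T, t, ht, g', e⟩ := hS.exact_up_to_refinements g hg
    exact ⟨T, t, g', ht, e⟩
  · have : PreservesFiniteLimits F.obj := hF
    exact exists_map_eq_of_isColimit F.obj (kernel.condition p)
      (Abelian.epiIsCokernelOfKernel _ (limit.isLimit _)) x (hx _ (kernel.condition p))

end IsEpiDescent

end LinCat

/-! ### From abelian `Lex k A` back to epimorphisms of `A`. -/

namespace LinCat

open Opposite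

section Abelian

variable {C : Type u} [Category.{v} C] [Preadditive C]

theorem IsAbelian.exists_refinement_of_epi (h : IsAbelian C) {X Y Z : C} (f : X ⟶ Y) [Epi f]
    (g : Z ⟶ Y) : ∃ (T : C) (t : T ⟶ Z) (g' : T ⟶ X), Epi t ∧ t ≫ g = g' ≫ f := by
  obtain ⟨h, rfl⟩ := h
  obtain ⟨T, t, ht, g', e⟩ := surjective_up_to_refinements_of_epi f g
  exact ⟨T, t, g', ht, e⟩

theorem IsAbelian.exists_refinement_of_isColimit (h : IsAbelian C) {X Y Z T : C} {f : X ⟶ Y}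
    {p : Y ⟶ Z} (w : f ≫ p = 0) (hp : IsColimit (CokernelCofork.ofπ p w)) (g : T ⟶ Y)
    (hg : g ≫ p = 0) : ∃ (S : C) (s : S ⟶ T) (g' : S ⟶ X), Epi s ∧ s ≫ g = g' ≫ f := by
  obtain ⟨h, rfl⟩ := h
  have hS := ShortComplex.exact_of_g_is_cokernel (ShortComplex.mk f p w) hp
  obtain ⟨S, s, hs, g', e⟩ := hS.exact_up_to_refinements g hg
  exact ⟨S, s, g', hs, e⟩

theorem IsAbelian.exists_kernel_of_epi (h : IsAbelian C) {X Y : C} (p : X ⟶ Y) [Epi p] :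
    ∃ (K : C) (i : K ⟶ X), i ≫ p = 0 ∧
      ∀ ⦃Z : C⦄ (f : X ⟶ Z), i ≫ f = 0 → ∃ g, p ≫ g = f := by
  obtain ⟨h, rfl⟩ := h
  refine ⟨kernel p, kernel.ι p, kernel.condition p, fun Z f hf => ?_⟩
  exact ⟨_, ((Abelian.epiIsCokernelOfKernel _ (limit.isLimit (parallelPair p 0))).fac
    (CokernelCofork.ofπ f hf) WalkingParallelPair.one)⟩

end Abelian

variable {k : Type u} [CommRing k] {A : Type u} [Category.{u} A] [Preadditive A] [Linear k A]

instance (F : Lex k A) : PreservesFiniteLimits F.obj.obj := F.property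

/-- Morphisms of left exact functors are natural transformations. -/
def homMkLex {F G : Lex k A} (τ : F.obj.obj ⟶ G.obj.obj) : F ⟶ G :=
  (isLex k A).homMk ((isLinear k A).homMk τ)

theorem hom_ext_lex {F G : Lex k A} {φ ψ : F ⟶ G}
    (h : ∀ (b : A) (x : F.obj.obj.obj (op b)),
      φ.hom.hom.app (op b) x = ψ.hom.hom.app (op b) x) : φ = ψ := by
  apply ObjectProperty.hom_ext
  apply ObjectProperty.hom_ext
  ext b x
  exact h b.unop x

theorem naturality_lex {F G : Lex k A} (φ : F ⟶ G) {b c : A} (f : b ⟶ c)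
    (x : F.obj.obj.obj (op c)) :
    φ.hom.hom.app (op b) (F.obj.obj.map f.op x) = G.obj.obj.map f.op (φ.hom.hom.app (op c) x) :=
  NatTrans.naturality_apply φ.hom.hom f.op x

section Yoneda

instance linearYoneda_obj_linear (c : A) : ((linearYoneda k A).obj c).Linear k where
  map_smul f r := by
    ext g
    exact Linear.smul_comp _ _ _ r f.unop g

variable [HasFiniteColimits A]

instance preservesFiniteLimits_linearYoneda_obj (c : A) :
    PreservesFiniteLimits ((linearYoneda k A).obj c) := by
  refine preservesFiniteLimits_of_cokernel _ fun X Y f => ⟨fun g g' h => ?_, fun g hg => ?_⟩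
  · exact (cancel_epi (cokernel.π f)).1 h
  · exact ⟨cokernel.desc f g hg, cokernel.π_desc f g hg⟩

variable (k) in
/-- The representable functor `A(-, c)`, as a left exact functor. -/
noncomputable def yonedaLex (c : A) : Lex k A :=
  ⟨⟨(linearYoneda k A).obj c, inferInstance, inferInstance⟩,
    preservesFiniteLimits_linearYoneda_obj c⟩

/-- The morphism `A(-, c) ⟶ F` given by an element of `F c`. -/
noncomputable def yonedaLexLift {F : Lex k A} {c : A} (x : F.obj.obj.obj (op c)) :
    yonedaLex k c ⟶ F :=
  homMkLex
    { app b := ModuleCat.ofHom (X := (b.unop ⟶ c))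
        { toFun f := F.obj.obj.map f.op x
          map_add' f g := map_add_op_apply F.obj.obj f g x
          map_smul' r f := map_smul_op_apply F.obj.obj r f x }
      naturality b b' f := by
        ext g
        exact map_comp_op_apply F.obj.obj f.unop g x }

/-- The element of `F c` given by a morphism `A(-, c) ⟶ F`. -/
noncomputable def yonedaLexElement {F : Lex k A} {c : A} (φ : yonedaLex k c ⟶ F) :
    F.obj.obj.obj (op c) :=
  φ.hom.hom.app (op c) (𝟙 c)

theorem app_eq_map_yonedaLexElement {F : Lex k A} {c : A} (φ : yonedaLex k c ⟶ F) {b : A}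
    (f : b ⟶ c) :
    φ.hom.hom.app (op b) f = F.obj.obj.map f.op (yonedaLexElement φ) := by
  have := naturality_lex φ f (𝟙 c)
  rw [yonedaLexElement, ← this]
  exact congrArg (φ.hom.hom.app (op b)) (Category.comp_id f).symm

theorem yonedaLexElement_lift {F : Lex k A} {c : A} (x : F.obj.obj.obj (op c)) :
    yonedaLexElement (yonedaLexLift x) = x := by
  change F.obj.obj.map (𝟙 _) x = x
  simp

theorem yonedaLex_hom_ext {F : Lex k A} {c : A} {φ ψ : yonedaLex k c ⟶ F}
    (h : yonedaLexElement φ = yonedaLexElement ψ) : φ = ψ :=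
  hom_ext_lex fun b f => by
    erw [app_eq_map_yonedaLexElement φ f, app_eq_map_yonedaLexElement ψ f, h]

variable (k) in
/-- The morphism of representable functors given by a morphism of `A`. -/
noncomputable def yonedaLexMap {b c : A} (f : b ⟶ c) : yonedaLex k b ⟶ yonedaLex k c :=
  yonedaLexLift (F := yonedaLex k c) f

theorem yonedaLexElement_map_comp {F : Lex k A} {b c : A} (f : b ⟶ c) (φ : yonedaLex k c ⟶ F) :
    yonedaLexElement (yonedaLexMap k f ≫ φ) = F.obj.obj.map f.op (yonedaLexElement φ) := by
  rw [← app_eq_map_yonedaLexElement]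
  change φ.hom.hom.app (op b) (𝟙 b ≫ f) = _
  rw [Category.id_comp]

/-- Left exact functors send epimorphisms of `A` to injections, which by Yoneda is cancellation in
`Lex k A`. -/
instance epi_yonedaLexMap {b c : A} (p : b ⟶ c) [Epi p] : Epi (yonedaLexMap k p) where
  left_cancellation {F} φ ψ h := by
    apply yonedaLex_hom_ext
    apply injective_map_of_epi F.obj.obj p
    rw [← yonedaLexElement_map_comp, h, yonedaLexElement_map_comp]

theorem yonedaLexElement_zero {F : Lex k A} {c : A} :
    yonedaLexElement (0 : yonedaLex k c ⟶ F) = 0 := rfl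

theorem yonedaLexMap_comp_eq_zero {a b c : A} {f : a ⟶ b} {g : b ⟶ c} (w : f ≫ g = 0) :
    yonedaLexMap k f ≫ yonedaLexMap k g = 0 := by
  apply yonedaLex_hom_ext
  rw [yonedaLexElement_map_comp]
  change f ≫ 𝟙 b ≫ g = 0
  rw [Category.id_comp, w]

/-- The embedding `c ↦ A(-, c)` into left exact functors preserves cokernels. -/
noncomputable def isColimitYonedaLex {a b : A} (f : a ⟶ b) :
    IsColimit (CokernelCofork.ofπ (yonedaLexMap k (cokernel.π f))
      (yonedaLexMap_comp_eq_zero (cokernel.condition f))) := by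
  have key {F : Lex k A} (φ : yonedaLex k b ⟶ F) (hφ : yonedaLexMap k f ≫ φ = 0) :=
    exists_map_eq_of_isColimit F.obj.obj (cokernel.condition f) (cokernelIsCokernel f)
      (yonedaLexElement φ) (by rw [← yonedaLexElement_map_comp, hφ, yonedaLexElement_zero])
  refine CokernelCofork.IsColimit.ofπ _ _ (fun φ hφ => yonedaLexLift (key φ hφ).choose)
    (fun φ hφ => yonedaLex_hom_ext ?_) (fun φ hφ ψ hψ => ?_)
  · rw [yonedaLexElement_map_comp, yonedaLexElement_lift]
    exact (key φ hφ).choose_spec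
  · rw [← cancel_epi (yonedaLexMap k (cokernel.π f)), hψ]
    apply yonedaLex_hom_ext
    rw [yonedaLexElement_map_comp, yonedaLexElement_lift]
    exact (key φ hφ).choose_spec.symm

end Yoneda

section ReducedProduct

variable {I : Type u} (l : Filter I) (D : I → A)

variable (k) in
/-- The families of morphisms which are eventually zero. -/
def eventuallyZero (b : A) : Submodule k (∀ i, b ⟶ D i) where
  carrier := {u | ∀ᶠ i in l, u i = 0}
  add_mem' {u v} hu hv := by
    filter_upwards [hu, hv] with i h1 h2
    simp [h1, h2]
  zero_mem' := Filter.Eventually.of_forall fun _ => rfl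
  smul_mem' r u hu := by
    filter_upwards [hu] with i h1
    simp [h1]

variable (k) in
/-- Precomposition of families of morphisms. -/
def precompPi {a b : A} (f : a ⟶ b) : (∀ i, b ⟶ D i) →ₗ[k] (∀ i, a ⟶ D i) :=
  LinearMap.pi fun i => Linear.leftComp k (D i) f ∘ₗ LinearMap.proj i

theorem precompPi_apply {a b : A} (f : a ⟶ b) (u : ∀ i, b ⟶ D i) (i : I) :
    precompPi k D f u i = f ≫ u i := rfl

theorem eventuallyZero_le_comap {a b : A} (f : a ⟶ b) :
    eventuallyZero k l D b ≤ (eventuallyZero k l D a).comap (precompPi k D f) := by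
  intro u hu
  filter_upwards [hu] with i h
  rw [precompPi_apply, h, comp_zero]

variable (k) in
/-- The reduced product of the representable functors `A(-, D i)` along a filter. -/
def reducedProduct : Aᵒᵖ ⥤ ModuleCat.{u} k where
  obj b := ModuleCat.of k ((∀ i, b.unop ⟶ D i) ⧸ eventuallyZero k l D b.unop)
  map f := ModuleCat.ofHom
    (Submodule.mapQ _ _ (precompPi k D f.unop) (eventuallyZero_le_comap l D f.unop))
  map_id b := by
    ext u
    refine congrArg (Submodule.Quotient.mk) (funext fun i => ?_)
    exact Category.id_comp (u i)
  map_comp f g := by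
    ext u
    refine congrArg (Submodule.Quotient.mk) (funext fun i => ?_)
    exact Category.assoc g.unop f.unop (u i)

/-- The element of the reduced product given by a family of morphisms. -/
def reducedProductMk {b : A} (u : ∀ i, b ⟶ D i) : (reducedProduct k l D).obj (op b) :=
  Submodule.Quotient.mk u

theorem reducedProductMk_surjective {b : A} (x : (reducedProduct k l D).obj (op b)) :
    ∃ u, reducedProductMk l D u = x := Submodule.Quotient.mk_surjective _ x

theorem reducedProduct_map_mk {a b : A} (f : a ⟶ b) (u : ∀ i, b ⟶ D i) :
    (reducedProduct k l D).map f.op (reducedProductMk l D u) =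
      reducedProductMk l D (fun i => f ≫ u i) := rfl

theorem reducedProductMk_eq_zero {b : A} (u : ∀ i, b ⟶ D i) :
    (reducedProductMk l D u : (reducedProduct k l D).obj (op b)) = 0 ↔ ∀ᶠ i in l, u i = 0 :=
  Submodule.Quotient.mk_eq_zero _

theorem isLinear_reducedProduct : isLinear k A (reducedProduct k l D) := by
  refine ⟨⟨fun {X Y f g} => ?_⟩, ⟨fun {X Y} f r => ?_⟩⟩
  · ext x
    obtain ⟨u, rfl⟩ := Submodule.Quotient.mk_surjective _ x
    refine congrArg (Submodule.Quotient.mk) (funext fun i => ?_)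
    exact Preadditive.add_comp _ _ _ f.unop g.unop (u i)
  · ext x
    obtain ⟨u, rfl⟩ := Submodule.Quotient.mk_surjective _ x
    refine congrArg (Submodule.Quotient.mk) (funext fun i => ?_)
    exact Linear.smul_comp _ _ _ r f.unop (u i)

-- Factorizations through a cokernel are chosen coordinate by coordinate.
open Classical in
theorem preservesFiniteLimits_reducedProduct [HasFiniteColimits A] :
    PreservesFiniteLimits (reducedProduct k l D) := by
  have : (reducedProduct k l D).Additive := (isLinear_reducedProduct l D).1
  refine preservesFiniteLimits_of_cokernel _ fun X Y f =>
    ⟨(injective_iff_map_eq_zero _).2 fun x hx => ?_, fun x hx => ?_⟩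
  · obtain ⟨u, rfl⟩ := reducedProductMk_surjective l D x
    rw [reducedProduct_map_mk, reducedProductMk_eq_zero] at hx
    rw [reducedProductMk_eq_zero]
    filter_upwards [hx] with i hi
    exact (cancel_epi (cokernel.π f)).1 (hi.trans comp_zero.symm)
  · obtain ⟨u, rfl⟩ := reducedProductMk_surjective l D x
    rw [reducedProduct_map_mk, reducedProductMk_eq_zero] at hx
    -- The value `0` is used on coordinates where `f ≫ u i ≠ 0`; these are negligible for `l`.
    refine ⟨reducedProductMk l D
      (fun i => if h : f ≫ u i = 0 then cokernel.desc f (u i) h else 0), ?_⟩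
    rw [reducedProduct_map_mk, ← sub_eq_zero]
    refine (Submodule.Quotient.mk_eq_zero _).2 ?_
    filter_upwards [hx] with i hi
    change cokernel.π f ≫ _ - u i = 0
    rw [dif_pos hi, cokernel.π_desc, sub_self]

end ReducedProduct

section Surjectivity

variable [HasFiniteColimits A]

/-- An epimorphism `F ⟶ A(-, c)` hits an epimorphism with target `c`. -/
theorem exists_epi_of_epi_yonedaLex {F : Lex k A} {c : A} (φ : F ⟶ yonedaLex k c) [Epi φ] :
    ∃ (a : A) (x : F.obj.obj.obj (op a)) (p : a ⟶ c), Epi p ∧ φ.hom.hom.app (op a) x = p := by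
  have : HasBinaryBiproducts A := HasBinaryBiproducts.of_hasBinaryCoproducts
  let e (s : Σ a : A, F.obj.obj.obj (op a)) : s.1 ⟶ c := φ.hom.hom.app (op s.1) s.2
  let D (s : Σ a : A, F.obj.obj.obj (op a)) : A := cokernel (e s)
  -- The tail of `s` consists of the `t` such that `e s` dies in the cokernel of `e t`. Biproducts
  -- make the tails directed.
  let l : Filter (Σ a : A, F.obj.obj.obj (op a)) :=
    { sets := {U | ∃ s, ∀ t, e s ≫ cokernel.π (e t) = 0 → t ∈ U}
      univ_sets := ⟨⟨c, 0⟩, fun _ _ => trivial⟩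
      sets_of_superset := fun ⟨s, hs⟩ h => ⟨s, fun t ht => h (hs t ht)⟩
      inter_sets := by
        rintro U V ⟨s, hs⟩ ⟨s', hs'⟩
        refine ⟨⟨s.1 ⊞ s'.1, F.obj.obj.map biprod.fst.op s.2 + F.obj.obj.map biprod.snd.op s'.2⟩,
          fun t ht => ?_⟩
        have he : e ⟨s.1 ⊞ s'.1, F.obj.obj.map biprod.fst.op s.2 +
            F.obj.obj.map biprod.snd.op s'.2⟩ = biprod.fst ≫ e s + biprod.snd ≫ e s' := by
          change φ.hom.hom.app _ (_ + _) = _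
          rw [map_add, naturality_lex, naturality_lex]
          rfl
        rw [he] at ht
        constructor
        · apply hs
          simpa using biprod.inl ≫= ht
        · apply hs'
          simpa using biprod.inr ≫= ht }
  have hl (U : Set (Σ a : A, F.obj.obj.obj (op a))) :
      U ∈ l ↔ ∃ s, ∀ t, e s ≫ cokernel.π (e t) = 0 → t ∈ U := Iff.rfl
  let Q : Lex k A := ⟨⟨reducedProduct k l D, isLinear_reducedProduct l D⟩,
    preservesFiniteLimits_reducedProduct l D⟩
  let q : Q.obj.obj.obj (op c) := reducedProductMk l D fun s => cokernel.π (e s)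
  -- By the choice of filter, each value of `φ` annihilates almost all coordinates of `q`; as `φ` is
  -- epi, `q` itself vanishes.
  have h0 : φ ≫ yonedaLexLift q = φ ≫ 0 := hom_ext_lex fun b y => by
    rw [comp_zero]
    change reducedProductMk l D (fun s => e ⟨b, y⟩ ≫ cokernel.π (e s)) = 0
    rw [reducedProductMk_eq_zero]
    exact (hl _).2 ⟨⟨b, y⟩, fun t ht => ht⟩
  rw [cancel_epi] at h0
  have hq : q = 0 := by
    rw [← yonedaLexElement_lift (F := Q) q, h0, yonedaLexElement_zero]
  -- The coordinates of `q` vanish on the tail of `s`, which contains `s`; so `e s` has zero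
  -- cokernel.
  obtain ⟨s, hs⟩ := (hl _).1 ((reducedProductMk_eq_zero l D _).1 hq)
  exact ⟨s.1, s.2, e s, Preadditive.epi_of_cokernel_zero (hs s (cokernel.condition _)), rfl⟩

/-- The first two axioms are refinements between representables in `Lex k A`, evaluated at an
element where the refining epimorphism becomes an epimorphism of `A`. For the third, `x` is a
morphism out of a representable that vanishes on the kernel of `yonedaLexMap k p`, hence factors
through it. -/
theorem IsEpiDescent.of_isAbelian_lex (h : IsAbelian (Lex k A)) : IsEpiDescent k A where
  ore {X Y Z} p g hp := by
    obtain ⟨P, π, ρ, hπ, e⟩ := h.exists_refinement_of_epi (yonedaLexMap k p) (yonedaLexMap k g)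
    obtain ⟨T, x, t, ht, hx⟩ := exists_epi_of_epi_yonedaLex π
    refine ⟨T, t, ρ.hom.hom.app (op T) x, ht, ?_⟩
    have := congrArg (fun φ => φ.hom.hom.app (op T) x) e
    subst hx
    exact this
  exact {X Y Z} f g hg := by
    obtain ⟨P, π, ρ, hπ, e⟩ := h.exists_refinement_of_isColimit _ (isColimitYonedaLex (k := k) f)
      (yonedaLexMap k g) (yonedaLexMap_comp_eq_zero hg)
    obtain ⟨T, x, t, ht, hx⟩ := exists_epi_of_epi_yonedaLex π
    refine ⟨T, t, ρ.hom.hom.app (op T) x, ht, ?_⟩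
    have := congrArg (fun φ => φ.hom.hom.app (op T) x) e
    subst hx
    exact this
  exists_map_eq F hF {X Y} p hp x hx := by
    obtain ⟨K, i, hi, hK⟩ := h.exists_kernel_of_epi (yonedaLexMap k p)
    obtain ⟨ψ, hψ⟩ := hK (yonedaLexLift (F := ⟨F, hF⟩) x) (hom_ext_lex fun b y =>
      hx (i.hom.hom.app (op b) y) (congrArg (fun φ => φ.hom.hom.app (op b) y) hi))
    refine ⟨yonedaLexElement ψ, ?_⟩
    have := congrArg yonedaLexElement hψ
    rw [yonedaLexElement_map_comp, yonedaLexElement_lift] at this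
    exact this

end Surjectivity

end LinCat

/-! ### Finiteness in tensor products, and slices of presheaves. -/

namespace LinCat

open Opposite

section TensorProduct

variable {k : Type u} [CommRing k] {M M' N : Type v} [AddCommGroup M] [Module k M]
  [AddCommGroup M'] [Module k M'] [AddCommGroup N] [Module k N]

/-- If `(π ⊗ N) x = 0` then this is witnessed by a finitely generated submodule `H` of the target:
`x` comes from `ker π ⊗ N` as soon as the elements of `H` come from the source of `π`. -/
theorem exists_fg_of_rTensor_eq_zero (π : M →ₗ[k] M') (x : M ⊗[k] N) (hx : π.rTensor N x = 0) :
    ∃ H : Submodule k M', H.FG ∧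
      ∀ {M₁ M₁' P : Type v} [AddCommGroup M₁] [Module k M₁] [AddCommGroup M₁'] [Module k M₁']
        [AddCommGroup P] [Module k P] (π₁ : M₁ →ₗ[k] M₁') (σ : M →ₗ[k] M₁) (τ : M' →ₗ[k] M₁'),
        (∀ m, π₁ (σ m) = τ (π m)) → (∀ h ∈ H, τ h ∈ LinearMap.range π₁) →
        ∀ β : M₁ ⊗[k] N →ₗ[k] P, (∀ m n, π₁ m = 0 → β (m ⊗ₜ n) = 0) →
          β (σ.rTensor N x) = 0 := by
  obtain ⟨M₀, hM₀, x₀, rfl⟩ := TensorProduct.exists_of_fg x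
  let π₀ := π.submoduleMap M₀
  have h0 : (M₀.map π).subtype.rTensor N (π₀.rTensor N x₀) = 0 := by
    rw [← hx, ← LinearMap.rTensor_comp_apply, ← LinearMap.rTensor_comp_apply]
    rfl
  -- A tensor that vanishes already vanishes over some finitely generated `H` containing the image
  -- of `M₀`.
  obtain ⟨H, hle, hH, h1⟩ := TensorProduct.eq_zero_of_fg_of_subtype_eq_zero (hM₀.map π) h0
  refine ⟨H, hH, fun {M₁ M₁' P} _ _ _ _ _ _ π₁ σ τ hc hτ β hβ => ?_⟩
  -- Since `τ` maps `H` into the range of `π₁`, the image of `x` dies in `range π₁ ⊗ N`. Right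
  -- exactness then puts it in the image of `ker π₁ ⊗ N`, where `β` is zero.
  let τ' : H →ₗ[k] LinearMap.range π₁ := τ.restrict hτ
  have hx' : π₁.rangeRestrict.rTensor N (σ.rTensor N (M₀.subtype.rTensor N x₀)) = 0 := by
    have : π₁.rangeRestrict ∘ₗ σ ∘ₗ M₀.subtype = τ' ∘ₗ Submodule.inclusion hle ∘ₗ π₀ := by
      ext m
      exact hc m
    rw [← LinearMap.rTensor_comp_apply, ← LinearMap.rTensor_comp_apply, LinearMap.comp_assoc, this,
      LinearMap.rTensor_comp_apply, LinearMap.rTensor_comp_apply, h1, map_zero]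
  have hex : Function.Exact (LinearMap.ker π₁).subtype π₁.rangeRestrict := by
    rw [LinearMap.exact_iff, Submodule.range_subtype, LinearMap.ker_rangeRestrict]
  obtain ⟨y, hy⟩ := (rTensor_exact N hex π₁.surjective_rangeRestrict _).1 hx'
  have hβ0 : β ∘ₗ (LinearMap.ker π₁).subtype.rTensor N = 0 :=
    TensorProduct.ext' fun m n => hβ m n m.2
  rw [← hy]
  exact LinearMap.congr_fun hβ0 y

theorem exists_fg_of_lTensor_eq_zero (π : M →ₗ[k] M') (x : N ⊗[k] M) (hx : π.lTensor N x = 0) :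
    ∃ H : Submodule k M', H.FG ∧
      ∀ {M₁ M₁' P : Type v} [AddCommGroup M₁] [Module k M₁] [AddCommGroup M₁'] [Module k M₁']
        [AddCommGroup P] [Module k P] (π₁ : M₁ →ₗ[k] M₁') (σ : M →ₗ[k] M₁) (τ : M' →ₗ[k] M₁'),
        (∀ m, π₁ (σ m) = τ (π m)) → (∀ h ∈ H, τ h ∈ LinearMap.range π₁) →
        ∀ β : N ⊗[k] M₁ →ₗ[k] P, (∀ m n, π₁ m = 0 → β (n ⊗ₜ m) = 0) →
          β (σ.lTensor N x) = 0 := by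
  have hc {Q Q' : Type v} [AddCommGroup Q] [Module k Q] [AddCommGroup Q'] [Module k Q']
      (f : Q →ₗ[k] Q') (y : N ⊗[k] Q) :
      f.rTensor N (TensorProduct.comm k N Q y) = TensorProduct.comm k N Q' (f.lTensor N y) := by
    induction y using TensorProduct.induction_on with
    | zero => simp
    | tmul n m => simp
    | add a b ha hb => simp only [map_add, ha, hb]
  obtain ⟨H, hH, h⟩ := exists_fg_of_rTensor_eq_zero π (TensorProduct.comm k N M x)
    (by rw [hc, hx, map_zero])
  refine ⟨H, hH, fun {M₁ M₁' P} _ _ _ _ _ _ π₁ σ τ hst hτ β hβ => ?_⟩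
  have := h π₁ σ τ hst hτ (β ∘ₗ (TensorProduct.comm k N M₁).symm.toLinearMap)
    (fun m n hm => by simpa using hβ m n hm)
  rw [hc] at this
  simpa using this

end TensorProduct

/-- The Ore condition handles a single generator; common refinements handle sums. -/
theorem IsCovering.exists_lift_of_fg {k : Type u} [CommRing k] {C : Type u₁} [Category.{v} C]
    [Preadditive C] [Linear k C] {W : MorphismProperty C} (hW : IsCovering W) {X Y Z : C}
    (p : X ⟶ Y) (hp : W p) {H : Submodule k (Z ⟶ Y)} (hH : H.FG) :
    ∃ (T : C) (t : T ⟶ Z), W t ∧ ∀ h ∈ H, ∃ h' : T ⟶ X, h' ≫ p = t ≫ h := by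
  induction H, hH using Submodule.fg_induction with
  | singleton h =>
    obtain ⟨T, t, g', ht, e⟩ := hW.ore p h hp
    refine ⟨T, t, ht, fun h1 h2 => ?_⟩
    obtain ⟨r, rfl⟩ := Submodule.mem_span_singleton.1 h2
    exact ⟨r • g', by rw [Linear.smul_comp, Linear.comp_smul, e]⟩
  | sup N₁ N₂ _ _ h₁ h₂ =>
    obtain ⟨T₁, t₁, ht₁, h₁⟩ := h₁
    obtain ⟨T₂, t₂, ht₂, h₂⟩ := h₂
    obtain ⟨T, u, v, hv, e⟩ := hW.exists_common ht₁ ht₂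
    refine ⟨T, v ≫ t₂, hv, fun h hh => ?_⟩
    obtain ⟨a, ha, b, hb, rfl⟩ := Submodule.mem_sup.1 hh
    obtain ⟨a', ha'⟩ := h₁ a ha
    obtain ⟨b', hb'⟩ := h₂ b hb
    refine ⟨u ≫ a' + v ≫ b', ?_⟩
    rw [Preadditive.add_comp, Category.assoc, Category.assoc, ha', hb', Preadditive.comp_add,
      ← Category.assoc, e, ← Category.assoc]

section Slices

variable {k : Type u} [CommRing k] {A : Type u} [Category.{u} A] [Preadditive A] [Linear k A]
  {B : Type u} [Category.{u} B] [Preadditive B] [Linear k B]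

instance inFst_additive (b : B) : (Tensor.inFst k A B b).Additive where
  map_add := TensorProduct.add_tmul _ _ _

instance inSnd_additive (a : A) : (Tensor.inSnd k A B a).Additive where
  map_add := TensorProduct.tmul_add _ _ _

theorem inFst_map_smul (b : B) {X Y : A} (f : X ⟶ Y) (r : k) :
    (Tensor.inFst k A B b).map (r • f) = r • (Tensor.inFst k A B b).map f := rfl

theorem inSnd_map_smul (a : A) {X Y : B} (f : X ⟶ Y) (r : k) :
    (Tensor.inSnd k A B a).map (r • f) = r • (Tensor.inSnd k A B a).map f :=
  TensorProduct.tmul_smul (R := k) r (𝟙 a : a ⟶ a) f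

/-- The presheaf `F(-, b)`. -/
def sliceFst (F : Presheaf k (Tensor k A B)) (b : B) : Presheaf k A :=
  ⟨(Tensor.inFst k A B b).op ⋙ F.obj, inferInstance, ⟨fun f r => by
    change F.obj.map ((Tensor.inFst k A B b).map (r • f.unop)).op = _
    rw [inFst_map_smul]
    exact F.obj.map_smul r ((Tensor.inFst k A B b).map f.unop).op⟩⟩

/-- The presheaf `F(a, -)`. -/
def sliceSnd (F : Presheaf k (Tensor k A B)) (a : A) : Presheaf k B :=
  ⟨(Tensor.inSnd k A B a).op ⋙ F.obj, inferInstance, ⟨fun f r => by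
    change F.obj.map ((Tensor.inSnd k A B a).map (r • f.unop)).op = _
    rw [inSnd_map_smul]
    exact F.obj.map_smul r ((Tensor.inSnd k A B a).map f.unop).op⟩⟩

theorem isBiLex_iff_isLex_slices (F : Presheaf k (Tensor k A B)) :
    isBiLex k A B F ↔ (∀ b, isLex k A (sliceFst F b)) ∧ ∀ a, isLex k B (sliceSnd F a) := Iff.rfl

end Slices

end LinCat

/-! ### Biexact functors as sheaves on `A ⊗ B`. -/

namespace LinCat

open Opposite

variable {k : Type u} [CommRing k] {A : Type u} [Category.{u} A] [Preadditive A] [Linear k A]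
  {B : Type u} [Category.{u} B] [Preadditive B] [Linear k B]

namespace Tensor

variable (k) in
/-- The morphism `f ⊗ g`, between explicit pairs of objects. -/
def mkHom {a a' : A} {b b' : B} (f : a ⟶ a') (g : b ⟶ b') :
    (⟨a, b⟩ : Tensor k A B) ⟶ ⟨a', b'⟩ :=
  tmul (X := ⟨a, b⟩) (Y := ⟨a', b'⟩) f g

theorem mkHom_comp {a a' a'' : A} {b b' b'' : B} (f : a ⟶ a') (g : b ⟶ b') (f' : a' ⟶ a'')
    (g' : b' ⟶ b'') : mkHom k f g ≫ mkHom k f' g' = mkHom k (f ≫ f') (g ≫ g') :=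
  tmul_comp_tmul (X := ⟨a, b⟩) (Y := ⟨a', b'⟩) (Z := ⟨a'', b''⟩) f g f' g'

theorem mkHom_zero_left {a a' : A} {b b' : B} (g : b ⟶ b') :
    mkHom k (0 : a ⟶ a') g = 0 :=
  TensorProduct.zero_tmul _ _

theorem mkHom_zero_right {a a' : A} {b b' : B} (f : a ⟶ a') :
    mkHom k f (0 : b ⟶ b') = 0 :=
  TensorProduct.tmul_zero _ _

variable (k) in
/-- The module of morphisms in `A ⊗ B` is a tensor product. -/
def homEquiv (a a' : A) (b b' : B) :
    ((⟨a, b⟩ : Tensor k A B) ⟶ ⟨a', b'⟩) ≃ₗ[k] (a ⟶ a') ⊗[k] (b ⟶ b') where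
  toFun w := w
  invFun w := w
  map_add' _ _ := rfl
  map_smul' _ _ := rfl

@[elab_as_elim]
theorem hom_induction {a a' : A} {b b' : B}
    {motive : ((⟨a, b⟩ : Tensor k A B) ⟶ ⟨a', b'⟩) → Prop}
    (zero : motive 0) (mkHom : ∀ f g, motive (mkHom k f g))
    (add : ∀ x y, motive x → motive y → motive (x + y)) (w) : motive w :=
  TensorProduct.induction_on (motive := motive) w zero mkHom add

theorem homEquiv_comp_fst {a a' a'' : A} {b b' : B} (p : a' ⟶ a'')
    (w : (⟨a, b⟩ : Tensor k A B) ⟶ ⟨a', b'⟩) :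
    homEquiv k _ _ _ _ (w ≫ mkHom k p (𝟙 b')) =
      (Linear.rightComp k a p).rTensor _ (homEquiv k _ _ _ _ w) := by
  induction w using hom_induction with
  | zero => rw [zero_comp, map_zero, map_zero, map_zero]
  | mkHom f g => rw [mkHom_comp, Category.comp_id]; rfl
  | add x y hx hy => rw [Preadditive.add_comp, map_add, map_add, map_add, hx, hy]

theorem homEquiv_comp_snd {a a' : A} {b b' b'' : B} (p : b' ⟶ b'')
    (w : (⟨a, b⟩ : Tensor k A B) ⟶ ⟨a', b'⟩) :
    homEquiv k _ _ _ _ (w ≫ mkHom k (𝟙 a') p) =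
      (Linear.rightComp k b p).lTensor _ (homEquiv k _ _ _ _ w) := by
  induction w using hom_induction with
  | zero => rw [zero_comp, map_zero, map_zero, map_zero]
  | mkHom f g => rw [mkHom_comp, Category.comp_id]; rfl
  | add x y hx hy => rw [Preadditive.add_comp, map_add, map_add, map_add, hx, hy]

theorem fst_comp_eq {a a' a'' : A} {b b' : B} (t : a ⟶ a')
    (w : (⟨a', b⟩ : Tensor k A B) ⟶ ⟨a'', b'⟩) :
    mkHom k t (𝟙 b) ≫ w = (homEquiv k _ _ _ _).symm
      ((Linear.leftComp k a'' t).rTensor _ (homEquiv k _ _ _ _ w)) := by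
  induction w using hom_induction with
  | zero => rw [comp_zero, map_zero, map_zero, map_zero]
  | mkHom f g => rw [mkHom_comp, Category.id_comp]; rfl
  | add x y hx hy => rw [Preadditive.comp_add, map_add, map_add, map_add, hx, hy]

theorem snd_comp_eq {a a' : A} {b b' b'' : B} (t : b ⟶ b')
    (w : (⟨a, b'⟩ : Tensor k A B) ⟶ ⟨a', b''⟩) :
    mkHom k (𝟙 a) t ≫ w = (homEquiv k _ _ _ _).symm
      ((Linear.leftComp k b'' t).lTensor _ (homEquiv k _ _ _ _ w)) := by
  induction w using hom_induction with
  | zero => rw [comp_zero, map_zero, map_zero, map_zero]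
  | mkHom f g => rw [mkHom_comp, Category.id_comp]; rfl
  | add x y hx hy => rw [Preadditive.comp_add, map_add, map_add, map_add, hx, hy]

end Tensor

section Covering

/-- The tensor products of two morphisms of given classes. -/
inductive tensorClass (k : Type u) [CommRing k] {A : Type u} [Category.{u} A] [Preadditive A]
    [Linear k A] {B : Type u} [Category.{u} B] [Preadditive B] [Linear k B]
    (W₁ : MorphismProperty A) (W₂ : MorphismProperty B) : MorphismProperty (Tensor k A B)
  | mk {a a' : A} {b b' : B} (p : a ⟶ a') (q : b ⟶ b') (hp : W₁ p) (hq : W₂ q) :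
    tensorClass k W₁ W₂ (Tensor.mkHom k p q)

theorem IsCovering.tensor {W₁ : MorphismProperty A} {W₂ : MorphismProperty B}
    (h₁ : IsCovering W₁) (h₂ : IsCovering W₂) : IsCovering (tensorClass k W₁ W₂) where
  id_mem X := .mk (𝟙 X.fst) (𝟙 X.snd) (h₁.id_mem _) (h₂.id_mem _)
  comp_mem := by
    rintro _ _ _ _ _ ⟨p, q, hp, hq⟩ ⟨p', q', hp', hq'⟩
    rw [Tensor.mkHom_comp]
    exact .mk _ _ (h₁.comp_mem _ _ hp hp') (h₂.comp_mem _ _ hq hq')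
  ore := by
    rintro _ _ ⟨c, d⟩ _ g ⟨p, q, hp, hq⟩
    -- Keeping the two factors of the refinement separate lets the sum case refine each of them
    -- independently.
    suffices ∃ (z : A) (z' : B) (t : z ⟶ c) (t' : z' ⟶ d) (g' : Tensor.mk z z' ⟶ _),
        W₁ t ∧ W₂ t' ∧ Tensor.mkHom k t t' ≫ g = g' ≫ Tensor.mkHom k p q by
      obtain ⟨z, z', t, t', g', ht, ht', e⟩ := this
      exact ⟨_, _, g', .mk t t' ht ht', e⟩
    induction g using Tensor.hom_induction with
    | zero =>
      exact ⟨c, d, 𝟙 c, 𝟙 d, 0, h₁.id_mem _, h₂.id_mem _, by rw [zero_comp, comp_zero]⟩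
    | mkHom f f' =>
      obtain ⟨T, t, g, ht, e⟩ := h₁.ore p f hp
      obtain ⟨T', t', g', ht', e'⟩ := h₂.ore q f' hq
      exact ⟨T, T', t, t', Tensor.mkHom k g g', ht, ht', by
        rw [Tensor.mkHom_comp, e, e', Tensor.mkHom_comp]⟩
    | add x y hx hy =>
      obtain ⟨T, T', t, t', g, ht, ht', e⟩ := hx
      obtain ⟨S, S', s, s', g', hs, hs', e'⟩ := hy
      obtain ⟨R, u, v, hv, e₁⟩ := h₁.exists_common ht hs
      obtain ⟨R', u', v', hv', e₂⟩ := h₂.exists_common ht' hs'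
      refine ⟨R, R', v ≫ s, v' ≫ s', Tensor.mkHom k u u' ≫ g + Tensor.mkHom k v v' ≫ g',
        hv, hv', ?_⟩
      rw [Preadditive.add_comp, Category.assoc, Category.assoc, ← e, ← e', ← Category.assoc,
        ← Category.assoc, Tensor.mkHom_comp, Tensor.mkHom_comp, e₁, e₂, Preadditive.comp_add]

end Covering

section Descent

variable (F : Presheaf k (Tensor k A B))

theorem isDescent_sliceFst_iff {a a' : A} (p : a ⟶ a') (b : B) :
    IsDescent (sliceFst F b).obj p ↔
      Function.Injective (F.obj.map (Tensor.mkHom k p (𝟙 b)).op) ∧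
      ∀ x : F.obj.obj (op ⟨a, b⟩),
        (∀ ⦃z : A⦄ (w : z ⟶ a), w ≫ p = 0 → F.obj.map (Tensor.mkHom k w (𝟙 b)).op x = 0) →
          ∃ y, F.obj.map (Tensor.mkHom k p (𝟙 b)).op y = x :=
  ⟨fun h => ⟨h.1, h.2⟩, fun h => ⟨h.1, h.2⟩⟩

theorem isDescent_sliceSnd_iff {b b' : B} (p : b ⟶ b') (a : A) :
    IsDescent (sliceSnd F a).obj p ↔
      Function.Injective (F.obj.map (Tensor.mkHom k (𝟙 a) p).op) ∧
      ∀ x : F.obj.obj (op ⟨a, b⟩),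
        (∀ ⦃z : B⦄ (w : z ⟶ b), w ≫ p = 0 → F.obj.map (Tensor.mkHom k (𝟙 a) w).op x = 0) →
          ∃ y, F.obj.map (Tensor.mkHom k (𝟙 a) p).op y = x :=
  ⟨fun h => ⟨h.1, h.2⟩, fun h => ⟨h.1, h.2⟩⟩

theorem map_mkHom_eq_snd_fst {a a' : A} {b b' : B} (f : a ⟶ a') (g : b ⟶ b')
    (x : F.obj.obj (op ⟨a', b'⟩)) :
    F.obj.map (Tensor.mkHom k f g).op x =
      F.obj.map (Tensor.mkHom k (𝟙 a) g).op (F.obj.map (Tensor.mkHom k f (𝟙 b')).op x) := by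
  rw [← map_comp_op_apply, Tensor.mkHom_comp, Category.id_comp, Category.comp_id]

theorem map_mkHom_eq_fst_snd {a a' : A} {b b' : B} (f : a ⟶ a') (g : b ⟶ b')
    (x : F.obj.obj (op ⟨a', b'⟩)) :
    F.obj.map (Tensor.mkHom k f g).op x =
      F.obj.map (Tensor.mkHom k f (𝟙 b)).op (F.obj.map (Tensor.mkHom k (𝟙 a') g).op x) := by
  rw [← map_comp_op_apply, Tensor.mkHom_comp, Category.id_comp, Category.comp_id]

/-- An element descends along `p`, then along `q`. The vanishing needed for the second descent is
tested after restriction along `p ⊗ 1`, which is injective. -/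
theorem isDescent_mkHom {a a' : A} {b b' : B} (p : a ⟶ a') (q : b ⟶ b')
    (hp : ∀ b, IsDescent (sliceFst F b).obj p) (hq : ∀ a, IsDescent (sliceSnd F a).obj q) :
    IsDescent F.obj (Tensor.mkHom k p q) := by
  simp only [isDescent_sliceFst_iff] at hp
  simp only [isDescent_sliceSnd_iff] at hq
  refine ⟨fun x y h => ?_, fun x hx => ?_⟩
  · rw [map_mkHom_eq_snd_fst, map_mkHom_eq_snd_fst F p q y] at h
    exact (hp b').1 ((hq a).1 h)
  · obtain ⟨y, hy⟩ := (hp b).2 x fun z w hw => hx _ (by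
      rw [Tensor.mkHom_comp, hw, Tensor.mkHom_zero_left])
    obtain ⟨z, hz⟩ := (hq a').2 y fun z w hw => by
      apply (hp z).1
      rw [map_zero, ← map_mkHom_eq_fst_snd, map_mkHom_eq_snd_fst, hy]
      exact hx _ (by rw [Tensor.mkHom_comp, hw, Tensor.mkHom_zero_right])
    exact ⟨z, by rw [map_mkHom_eq_fst_snd, hz, hy]⟩

/-- The action of the morphisms of `A ⊗ B` on a given element, as a linear map. -/
def evalTensor {a' : A} {b' : B} (x : F.obj.obj (op ⟨a', b'⟩)) (a : A) (b : B) :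
    (a ⟶ a') ⊗[k] (b ⟶ b') →ₗ[k] F.obj.obj (op ⟨a, b⟩) where
  toFun f := F.obj.map ((Tensor.homEquiv k a a' b b').symm f).op x
  map_add' f g := by rw [map_add, map_add_op_apply]
  map_smul' r f := by rw [map_smul, map_smul_op_apply]; rfl

/-- Descent along `p ⊗ 1` in `A ⊗ B` demands vanishing on every tensor `w` killed by `p ⊗ 1`,
whereas the slice only supplies pure `w ⊗ 1`. After a refinement `t` lifting the finitely many
morphisms in `H`, `w` comes from the kernel of `p` tensored with the second factor. -/
theorem isDescent_sliceFst {W₁ : MorphismProperty A} (h₁ : IsCovering W₁)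
    (h : ∀ ⦃a a' : A⦄ (p : a ⟶ a') (b : B), W₁ p → IsDescent F.obj (Tensor.mkHom k p (𝟙 b)))
    (b : B) {a a' : A} (p : a ⟶ a') (hp : W₁ p) : IsDescent (sliceFst F b).obj p := by
  rw [isDescent_sliceFst_iff]
  refine ⟨(h p b hp).injective, fun x hx => (h p b hp).exists_map_eq x ?_⟩
  rintro ⟨z, d⟩ w hw
  obtain ⟨H, hH, key⟩ := exists_fg_of_rTensor_eq_zero (Linear.rightComp k z p)
    (Tensor.homEquiv k _ _ _ _ w) (by rw [← Tensor.homEquiv_comp_fst, hw, map_zero])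
  obtain ⟨T, t, ht, hT⟩ := h₁.exists_lift_of_fg p hp hH
  apply (h t d ht).injective
  rw [map_zero, ← map_comp_op_apply, Tensor.fst_comp_eq]
  exact key (Linear.rightComp k T p) (Linear.leftComp k a t) (Linear.leftComp k a' t)
    (fun m => Category.assoc _ _ _) hT (evalTensor F x T d) fun m n hm => by
      refine (map_mkHom_eq_snd_fst F m n x).trans ?_
      rw [hx m hm, map_zero]

theorem isDescent_sliceSnd {W₂ : MorphismProperty B} (h₂ : IsCovering W₂)
    (h : ∀ ⦃b b' : B⦄ (q : b ⟶ b') (a : A), W₂ q → IsDescent F.obj (Tensor.mkHom k (𝟙 a) q))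
    (a : A) {b b' : B} (q : b ⟶ b') (hq : W₂ q) : IsDescent (sliceSnd F a).obj q := by
  rw [isDescent_sliceSnd_iff]
  refine ⟨(h q a hq).injective, fun x hx => (h q a hq).exists_map_eq x ?_⟩
  rintro ⟨c, z⟩ w hw
  obtain ⟨H, hH, key⟩ := exists_fg_of_lTensor_eq_zero (Linear.rightComp k z q)
    (Tensor.homEquiv k _ _ _ _ w) (by rw [← Tensor.homEquiv_comp_snd, hw, map_zero])
  obtain ⟨T, t, ht, hT⟩ := h₂.exists_lift_of_fg q hq hH
  apply (h t c ht).injective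
  rw [map_zero, ← map_comp_op_apply, Tensor.snd_comp_eq]
  exact key (Linear.rightComp k T q) (Linear.leftComp k b t) (Linear.leftComp k b' t)
    (fun m => Category.assoc _ _ _) hT (evalTensor F x c T) fun m n hm => by
      refine (map_mkHom_eq_fst_snd F n m x).trans ?_
      rw [hx m hm, map_zero]

variable [HasFiniteColimits A] [HasFiniteColimits B]

theorem isBiLex_iff_isSheaf (hA : IsEpiDescent k A) (hB : IsEpiDescent k B) :
    isBiLex k A B F ↔
      Presheaf.IsSheaf (hA.isCovering.tensor (k := k) hB.isCovering).topology F.obj := by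
  rw [isBiLex_iff_isLex_slices, isSheaf_topology_iff]
  constructor
  · rintro ⟨h₁, h₂⟩ X Y _ ⟨p, q, hp, hq⟩
    exact isDescent_mkHom F p q (fun b => (hA.isLex_iff _).1 (h₁ b) p hp)
      (fun a => (hB.isLex_iff _).1 (h₂ a) q hq)
  · intro h
    refine ⟨fun b => (hA.isLex_iff _).2 fun X Y p hp => ?_,
      fun a => (hB.isLex_iff _).2 fun X Y q hq => ?_⟩
    · exact isDescent_sliceFst F hA.isCovering
        (fun _ _ p b hp => h _ (.mk p (𝟙 b) hp (hB.isCovering.id_mem b))) b p hp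
    · exact isDescent_sliceSnd F hB.isCovering
        (fun _ _ q a hq => h _ (.mk (𝟙 a) q (hA.isCovering.id_mem a) hq)) a q hq

end Descent

end LinCat

theorem mainTheorem4 (k : Type u) [CommRing k]
    (A : Type u) [Category.{u} A] [Preadditive A] [Linear k A]
    (B : Type u) [Category.{u} B] [Preadditive B] [Linear k B] :
    (HasFiniteColimits A → HasFiniteColimits B →
      LinCat.IsAbelian (LinCat.Lex k A) → LinCat.IsAbelian (LinCat.Lex k B) →
        (LinCat.biLexInclusion k A B).IsRightAdjoint ∧
        (∀ R : LinCat.Presheaf k (LinCat.Tensor k A B) ⥤ LinCat.BiLex k A B,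
          Nonempty (R ⊣ LinCat.biLexInclusion k A B) → PreservesFiniteLimits R) ∧
        LinCat.IsAbelian (LinCat.BiLex k A B)) ∧
    (LinCat.IsAbelian A → LinCat.IsAbelian B →
      LinCat.IsAbelian (LinCat.Lex k A) ∧ LinCat.IsAbelian (LinCat.Lex k B) ∧
        (LinCat.biLexInclusion k A B).IsRightAdjoint ∧
        (∀ R : LinCat.Presheaf k (LinCat.Tensor k A B) ⥤ LinCat.BiLex k A B,
          Nonempty (R ⊣ LinCat.biLexInclusion k A B) → PreservesFiniteLimits R) ∧
        LinCat.IsAbelian (LinCat.BiLex k A B)) := by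
  have key (_ : HasFiniteColimits A) (_ : HasFiniteColimits B) (hA : LinCat.IsEpiDescent k A)
      (hB : LinCat.IsEpiDescent k B) :=
    (hA.isCovering.tensor hB.isCovering).localization (LinCat.isBiLex k A B)
      fun F => LinCat.isBiLex_iff_isSheaf F hA hB
  refine ⟨fun _ _ hA hB => key _ _ (.of_isAbelian_lex hA) (.of_isAbelian_lex hB),
    fun hA hB => ?_⟩
  have : HasFiniteColimits A := by
    obtain ⟨_, -⟩ := hA
    infer_instance
  have : HasFiniteColimits B := by
    obtain ⟨_, -⟩ := hB
    infer_instance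
  have hA' := LinCat.IsEpiDescent.of_abelian (k := k) hA
  have hB' := LinCat.IsEpiDescent.of_abelian (k := k) hB
  exact ⟨hA'.isAbelian_lex, hB'.isAbelian_lex, key _ _ hA' hB'⟩
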